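/- Let $G$ be a finite group, $\operatorname{Irr} G$ its set of irreducible complex characters, and for $X\subseteq\operatorname{Irr}G$ put $\sigma_X=\sum_{\chi\in X}\chi(1)\chi$. A *supercharacter theory* of $G$ is a pair $(\mathcal X,\mathcal K)$ of a partition $\mathcal X$ of $\operatorname{Irr}G$ and a partition $\mathcal K$ of $G$ such that $|\mathcal X|=|\mathcal K|$ and every $\sigma_X$ ($X\in\mathcal X$) is constant on every member of $\mathcal K$; the members of $\mathcal K$ are its *superclasses*. Pairs of partitions are ordered by refinement in both components (finer is smaller), and coarsest supercharacter theories and meets of supercharacter theories refer to this order on the set of supercharacter theories. Let $M(G)$ be the pair of partitions $\big(\{\{1_G\},\operatorname{Irr}G\setminus\{1_G\}\},\{\{1\},G\setminus\{1\}\}\big)$ (empty sets being omitted, which matters only if $G$ is trivial). For a collection $\mathcal X$ of subsets of $\operatorname{Irr}G$ let $C(\mathcal X)$ be the partition of $G$ into the classes of the relation $g\sim h\iff\sigma_X(g)=\sigma_X(h)$ for all $X\in\mathcal X$. For a collection $\mathcal K$ of normal (conjugation-invariant) subsets of $G$ let $I(\mathcal K)$ be the partition of $\operatorname{Irr}G$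 into the classes of the relation $\chi\sim\psi\iff\frac1{\chi(1)}\sum_{g\in K}\chi(g)=\frac1{\psi(1)}\sum_{g\in K}\psi(g)$ for all $K\in\mathcal K$. Starting from $\mathcal K$, compute the partitions $I(\mathcal K), CI(\mathcal K), ICI(\mathcal K),(CI)^2(\mathcal K),\dots$. We say that the number of blocks *stabilizes at* $n\ge 1$ if $(CI)^n(\mathcal K)$ has as many blocks as its predecessor $I(CI)^{n-1}(\mathcal K)$ or its successor $I(CI)^n(\mathcal K)$. Consider the following algorithm. 1. For each nonempty normal subset $S$ of $G\setminus\{1\}$ that contains at most half of the nontrivial conjugacy classes of $G$, compute the above partitions for $\mathcal K=\{S\}$, up to the first $n\ge1$ such that $S\notin(CI)^n(\{S\})$ or the number of blocks stabilizes at $n$. If $S\in(CI)^n(\{S\})$ for this $n$, put $L(S)=\big(I(CI)^n(\{S\}),(CI)^n(\{S\})\big)$ and add $L(S)$ to the set $\mathcal S$ (initially empty). 2. Add to $\mathcal S$ the meets (among supercharacter theories) of all sets of two or more members of $\mathcal S$. 3. Add $M(G)$ to $\mathcal S$. Then the algorithm is correct: (a) For every $S$ as in step 1 there is such an $n$. If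 $S\in(CI)^n(\{S\})$ for this $n$, then $L(S)$ is the coarsest supercharacter theory of $G$ that has $S$ as a superclass; otherwise no supercharacter theory of $G$ has $S$ as a superclass. (b) Every nonempty set of supercharacter theories $(\mathcal X_i,\mathcal K_i)$ of $G$ has a meet among the supercharacter theories, computed as follows: for the partition $\mathcal K=\bigwedge_i\mathcal K_i$ of $G$ (the meet in the lattice of partitions) there is a first $n\ge1$ at which the number of blocks stabilizes, and the meet is $\big(I(CI)^n(\mathcal K),(CI)^n(\mathcal K)\big)$. (c) The resulting set $\mathcal S$ is exactly the set of all supercharacter theories of $G$. -/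

import Mathlib

noncomputable section

/-- `Irr G`: the irreducible complex characters of `G`, as functions `G → ℂ`. Every irreducible
representation of a finite group is finite dimensional, hence equivalent to one on some `ℂⁿ`. -/
def Irr (G : Type*) [Group G] : Type _ :=
  {χ : G → ℂ // ∃ (n : ℕ) (ρ : Representation ℂ G (Fin n → ℂ)),
    ρ.IsIrreducible ∧ ρ.character = χ}

namespace Irr

variable {G : Type*} [Group G]

instance : CoeFun (Irr G) (fun _ => G → ℂ) := ⟨Subtype.val⟩

theorem sum_mul_inv [Fintype G] (χ ψ : Irr G) :
    ∑ g : G, χ g * ψ g⁻¹ ≠ 0 ↔ χ = ψ := by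
  classical
  obtain ⟨χ, n, ρ, hρ, rfl⟩ := χ
  obtain ⟨ψ, m, τ, hτ, rfl⟩ := ψ
  have hc : (Nat.card G : ℂ) ≠ 0 := by
    exact_mod_cast Nat.card_pos.ne'
  let _ : Invertible (Nat.card G : ℂ) := invertibleOfNonzero hc
  have h := Representation.char_orthonormal ρ τ
  constructor
  · intro hne
    have : Nonempty (Representation.Equiv τ ρ) := by
      by_contra hcon
      rw [if_neg hcon] at h
      exact hne ((mul_eq_zero.mp h).resolve_left (inv_ne_zero hc))
    obtain ⟨e⟩ := this
    exact Subtype.ext (Representation.char_iso e).symm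
  · intro he hz
    have he' : ρ.character = τ.character := congrArg Subtype.val he
    have h2 := Representation.char_orthonormal ρ ρ
    rw [if_pos ⟨Representation.Equiv.refl ρ⟩] at h2
    dsimp only at hz
    rw [← he'] at hz
    rw [hz] at h2
    simp at h2

theorem linearIndependent [Finite G] :
    LinearIndependent ℂ (fun χ : Irr G => (χ.1 : G → ℂ)) := by
  classical
  have := Fintype.ofFinite G
  rw [linearIndependent_iff']
  intro s c hs ψ hψ
  have h1 : ∑ g : G, (∑ χ ∈ s, c χ • (χ.1 : G → ℂ)) g * ψ g⁻¹ = 0 := by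
    rw [hs]; simp
  have h2 : ∑ g : G, (∑ χ ∈ s, c χ • (χ.1 : G → ℂ)) g * ψ g⁻¹
      = ∑ χ ∈ s, c χ * ∑ g : G, χ g * ψ g⁻¹ := by
    simp only [Finset.sum_apply, Pi.smul_apply, smul_eq_mul, Finset.sum_mul, Finset.mul_sum]
    rw [Finset.sum_comm]
    simp only [mul_assoc]
  rw [h2, Finset.sum_eq_single ψ] at h1
  · exact (mul_eq_zero.mp h1).resolve_right ((sum_mul_inv ψ ψ).2 rfl)
  · intro χ _ hne
    have : ∑ g : G, χ g * ψ g⁻¹ = 0 := by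
      by_contra hcon
      exact hne ((sum_mul_inv χ ψ).1 hcon)
    rw [this, mul_zero]
  · exact fun h => absurd hψ h

/-- There are only finitely many irreducible characters, so that the sums over sets of characters
and the numbers of blocks below are the usual ones. -/
instance [Finite G] : Finite (Irr G) := linearIndependent.finite

end Irr

namespace SCT

variable {G : Type*} [Group G]

/-- `σ_X = ∑_{χ ∈ X} χ(1) χ`. -/
def sigma (X : Set (Irr G)) (g : G) : ℂ := ∑ᶠ χ ∈ X, χ 1 * χ g

/-- `ω_χ(K̂) = χ(K̂) / χ(1)`, where `K̂` is the sum of the elements of `K`. -/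
def omega (χ : Irr G) (K : Set G) : ℂ := (∑ᶠ g ∈ K, χ g) / χ 1

/-- A pair consisting of a partition of `Irr G` and a partition of `G`. Partitions are given by
their equivalence relations; `Setoid.classes` is the set of blocks, and `r ≤ s` means that `r` is
finer than `s`. Pairs are ordered componentwise. -/
abbrev PartPair (G : Type*) [Group G] : Type _ := Setoid (Irr G) × Setoid G

/-- The number of blocks of a partition. -/
def numBlocks {α : Type*} (r : Setoid α) : ℕ := r.classes.ncard

/-- `(𝒳, 𝒦)` is a supercharacter theory: `|𝒳| = |𝒦|`, and every `σ_X` with `X ∈ 𝒳` is constant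
on every member of `𝒦`. -/
def IsTheory (P : PartPair G) : Prop :=
  numBlocks P.1 = numBlocks P.2 ∧
    ∀ X ∈ P.1.classes, ∀ K ∈ P.2.classes, ∀ g ∈ K, ∀ h ∈ K, sigma X g = sigma X h

/-- The partition `C(𝒳)` of `G` defined by a collection `𝒳` of subsets of `Irr G`. -/
def classPartition (𝒳 : Set (Set (Irr G))) : Setoid G where
  r g h := ∀ X ∈ 𝒳, sigma X g = sigma X h
  iseqv := ⟨fun _ _ _ => rfl, fun h X hX => (h X hX).symm,
    fun h₁ h₂ X hX => (h₁ X hX).trans (h₂ X hX)⟩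

/-- The partition `I(𝒦)` of `Irr G` defined by a collection `𝒦` of (normal) subsets of `G`. -/
def irrPartition (𝒦 : Set (Set G)) : Setoid (Irr G) where
  r χ ψ := ∀ K ∈ 𝒦, omega χ K = omega ψ K
  iseqv := ⟨fun _ _ _ => rfl, fun h K hK => (h K hK).symm,
    fun h₁ h₂ K hK => (h₁ K hK).trans (h₂ K hK)⟩

/-- `irrSeq 𝒦 n` is the partition `I(CI)ⁿ(𝒦)` of `Irr G`. -/
def irrSeq (𝒦 : Set (Set G)) : ℕ → Setoid (Irr G)
  | 0 => irrPartition 𝒦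
  | n + 1 => irrPartition (classPartition (irrSeq 𝒦 n).classes).classes

/-- `classSeq 𝒦 n` is the partition `(CI)ⁿ⁺¹(𝒦)` of `G`. So the successive partitions computed
from `𝒦` are `irrSeq 𝒦 0, classSeq 𝒦 0, irrSeq 𝒦 1, classSeq 𝒦 1, …`. -/
def classSeq (𝒦 : Set (Set G)) (n : ℕ) : Setoid G := classPartition (irrSeq 𝒦 n).classes

/-- In the sequence of partitions computed from `𝒦`, the partition `classSeq 𝒦 n` has as many
blocks as the one just before or the one just after it. -/
def Stabilizes (𝒦 : Set (Set G)) (n : ℕ) : Prop :=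
  numBlocks (irrSeq 𝒦 n) = numBlocks (classSeq 𝒦 n) ∨
    numBlocks (classSeq 𝒦 n) = numBlocks (irrSeq 𝒦 (n + 1))

/-- The pair `(I(CI)ⁿ⁺¹(𝒦), (CI)ⁿ⁺¹(𝒦))`. -/
def seqPair (𝒦 : Set (Set G)) (n : ℕ) : PartPair G := (irrSeq 𝒦 (n + 1), classSeq 𝒦 n)

/-- `S` is a nonempty normal subset of `G ∖ {1}` that contains at most half of the nontrivial
conjugacy classes of `G`. -/
def IsCandidate (S : Set G) : Prop :=
  S.Nonempty ∧ (1 : G) ∉ S ∧ (∀ g ∈ S, ∀ x : G, x * g * x⁻¹ ∈ S) ∧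
    2 * {c : ConjClasses G | c.carrier ⊆ S}.ncard ≤ {c : ConjClasses G | c ≠ 1}.ncard

/-- The computation for `S` in the first step of the algorithm stops in round `n`: this is the
first round in which `S` has been lost as a block or the number of blocks has stabilized. -/
def StopsAt (S : Set G) (n : ℕ) : Prop :=
  IsLeast {m : ℕ | S ∉ (classSeq {S} m).classes ∨ Stabilizes {S} m} n

/-- `P` is the coarsest supercharacter theory that has `S` as a superclass. -/
def IsCoarsestWith (S : Set G) (P : PartPair G) : Prop :=
  IsGreatest {T : PartPair G | IsTheory T ∧ S ∈ T.2.classes} P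

/-- `P` is the meet of the family `F` in the ordered set of supercharacter theories. -/
def IsMeet (F : Set (PartPair G)) (P : PartPair G) : Prop :=
  IsGreatest {T : PartPair G | IsTheory T ∧ T ∈ lowerBounds F} P

variable (G) in
/-- `M(G)`: the partitions of `Irr G` and of `G` into the trivial element and the rest (which is
omitted if it is empty). -/
def coarseTheory : PartPair G :=
  (Setoid.ker fun χ : Irr G => χ.1 = 1, Setoid.ker fun g : G => g = 1)

variable (G) in
/-- First step: the pairs found by the computations that end with `S` still a block. -/
def firstStep : Set (PartPair G) :=
  {P | ∃ S : Set G, IsCandidate S ∧ ∃ n, StopsAt S n ∧ S ∈ (classSeq {S} n).classes ∧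
    P = seqPair {S} n}

/-- Second step: add all meets of two or more members. -/
def addMeets (𝒮 : Set (PartPair G)) : Set (PartPair G) :=
  𝒮 ∪ {P | ∃ F ⊆ 𝒮, F.Nontrivial ∧ IsMeet F P}

variable (G) in
/-- The set computed by the algorithm: first step, second step, and third step (add `M(G)`). -/
def algorithmOutput : Set (PartPair G) := insert (coarseTheory G) (addMeets (firstStep G))

end SCT

end

/-! Identify a partition with the space of functions constant on its blocks; its dimension is the
number of blocks. Two maps link the sides: `irrTransform` sends block indicators of `Irr G` to the
σ_X, and `classTransform` sends block indicators of G to the values ω_χ. By orthogonality and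
completeness of the irreducible characters they are, up to complex conjugation and the factor |G|,
mutually inverse between functions on `Irr G` and class functions.

C(𝒳) and I(𝒦) are the coarsest partitions whose block functions contain the transformed ones. Hence
block counts never drop along the sequence, IC and CI (on normal partitions) refine, and equal
consecutive counts make the transform bijective on block functions, which gives a theory. Conversely
a theory satisfies C(𝒳) = 𝒦 and I(𝒦) = 𝒳, so by monotonicity any theory below the start stays below
every term. Thus the stabilized pair is the coarsest possible, which yields (a) and (b).

For (c), at most one nontrivial superclass of a theory T can contain more than half of the
nontrivial conjugacy classes. The other nontrivial superclasses S therefore determine T, and T is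
the meet of their L(S), a single L(S), or M(G) if there is no such S. -/

open Representation in
/-- Irreducibility is invariant under equivalence of representations. -/
theorem Representation.Equiv.isIrreducible {k G V W : Type*} [Field k] [Monoid G]
    [AddCommGroup V] [Module k V] [AddCommGroup W] [Module k W]
    {ρ : Representation k G V} {τ : Representation k G W} (e : ρ.Equiv τ)
    (h : ρ.IsIrreducible) : τ.IsIrreducible := by
  rw [irreducible_iff_isSimpleModule_asModule] at h ⊢
  have hb : Function.Bijective (IntertwiningMap.equivLinearMapAsModule ρ τ e.toIntertwiningMap) :=
    e.toLinearEquiv.bijective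
  exact IsSimpleModule.congr (LinearEquiv.ofBijective _ hb).symm

/-! ### Irreducible characters: orthogonality and completeness -/

namespace Irr

variable {G : Type*} [Group G]

/-- The character of a finite dimensional irreducible representation, as an element of `Irr G`. -/
theorem exists_eq_character {V : Type*} [AddCommGroup V] [Module ℂ V] [FiniteDimensional ℂ V]
    (ρ : Representation ℂ G V) (h : ρ.IsIrreducible) : ∃ χ : Irr G, χ.1 = ρ.character := by
  let e : V ≃ₗ[ℂ] (Fin (Module.finrank ℂ V) → ℂ) := (Module.finBasis ℂ V).equivFun
  let τ : Representation ℂ G (Fin (Module.finrank ℂ V) → ℂ) :=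
    (e.conjAlgEquiv ℂ).toMulEquiv.toMonoidHom.comp ρ
  let E : ρ.Equiv τ := Representation.Equiv.mk e fun g => by
    ext v; simp [τ, LinearEquiv.conjAlgEquiv_apply]
  exact ⟨⟨τ.character, _, τ, E.isIrreducible h, rfl⟩, (Representation.char_iso E).symm⟩

/-- The degree of an irreducible character. -/
theorem exists_degree (χ : Irr G) : ∃ n : ℕ, n ≠ 0 ∧ χ 1 = n := by
  obtain ⟨_, n, ρ, hρ, rfl⟩ := χ
  refine ⟨n, ?_, by simp⟩
  rintro rfl
  obtain ⟨a, b, hab⟩ := hρ.toNontrivial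
  exact hab (SetLike.coe_injective (Set.ext fun v => by
    rw [Subsingleton.elim v 0]
    exact iff_of_true a.toSubmodule.zero_mem b.toSubmodule.zero_mem))

theorem one_ne_zero (χ : Irr G) : χ 1 ≠ 0 := by
  obtain ⟨n, hn, h⟩ := χ.exists_degree
  rw [h]
  exact_mod_cast hn

theorem star_one (χ : Irr G) : star (χ 1) = χ 1 := by
  obtain ⟨n, -, h⟩ := χ.exists_degree
  simp [h]

theorem map_conj (χ : Irr G) (g x : G) : χ (x * g * x⁻¹) = χ g := by
  obtain ⟨_, n, ρ, hρ, rfl⟩ := χ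
  exact Representation.char_conj ρ g x

open Matrix in
open scoped ComplexOrder in
/-- Characters of finite groups take complex conjugate values on inverse elements, because
every complex representation preserves a positive definite form. -/
theorem map_inv [Finite G] (χ : Irr G) (g : G) : χ g⁻¹ = star (χ g) := by
  classical
  have := Fintype.ofFinite G
  obtain ⟨_, n, ρ, hρ, rfl⟩ := χ
  let A : G →* Matrix (Fin n) (Fin n) ℂ :=
    (LinearMap.toMatrixAlgEquiv' : _ ≃ₐ[ℂ] _).toMulEquiv.toMonoidHom.comp ρ
  have htr (x : G) : ρ.character x = (A x).trace :=
    LinearMap.trace_eq_matrix_trace ℂ (Pi.basisFun ℂ (Fin n)) (ρ x)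
  let H := ∑ x, (A x)ᴴ * A x
  -- The term x = 1 is the identity matrix, hence positive definite; the others are only needed
  -- semidefinite.
  have hH : H.PosDef := by
    have h1 : (1 : Matrix (Fin n) (Fin n) ℂ).PosDef := PosDef.one
    have h2 : (∑ x ∈ Finset.univ.erase 1, (A x)ᴴ * A x).PosSemidef :=
      posSemidef_sum _ fun x _ => posSemidef_conjTranspose_mul_self (A x)
    have h3 : H = 1 + ∑ x ∈ Finset.univ.erase 1, (A x)ᴴ * A x := by
      simp only [H]
      rw [← Finset.add_sum_erase _ _ (Finset.mem_univ (1 : G)), map_one]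
      simp
    rw [h3]
    exact h1.add_posSemidef h2
  have hinv : (A g)ᴴ * H * A g = H := by
    simp only [H, Finset.mul_sum, Finset.sum_mul]
    refine Fintype.sum_equiv (Equiv.mulRight g) _ _ fun x => ?_
    simp [Matrix.mul_assoc]
  have hg : A g * A g⁻¹ = 1 := by rw [← map_mul, mul_inv_cancel, map_one]
  have hu : IsUnit H.det := (Matrix.isUnit_iff_isUnit_det _).1 hH.isUnit
  -- Invariance of H makes A(g⁻¹) similar to the conjugate transpose of A(g), so the traces agree.
  have h4 : H * A g⁻¹ = (A g)ᴴ * H := by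
    calc H * A g⁻¹ = (A g)ᴴ * H * A g * A g⁻¹ := by rw [hinv]
      _ = (A g)ᴴ * H := by rw [Matrix.mul_assoc _ (A g), hg, Matrix.mul_one]
  change ρ.character g⁻¹ = star (ρ.character g)
  rw [htr, htr, ← Matrix.trace_conjTranspose]
  calc (A g⁻¹).trace = (H⁻¹ * (H * A g⁻¹)).trace := by
        rw [← Matrix.mul_assoc, Matrix.nonsing_inv_mul _ hu, Matrix.one_mul]
    _ = ((A g)ᴴ).trace := by
        rw [h4, Matrix.trace_mul_comm, Matrix.mul_assoc, Matrix.mul_nonsing_inv _ hu,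
          Matrix.mul_one]

/-- The first orthogonality relation. -/
theorem sum_mul_star [Fintype G] [DecidableEq (Irr G)] (χ ψ : Irr G) :
    ∑ g : G, χ g * star (ψ g) = if χ = ψ then (Nat.card G : ℂ) else 0 := by
  simp only [← map_inv]
  split_ifs with h
  · subst h
    obtain ⟨χ, n, ρ, hρ, rfl⟩ := χ
    have hc : (Nat.card G : ℂ) ≠ 0 := by exact_mod_cast Nat.card_pos.ne'
    let _ : Invertible (Nat.card G : ℂ) := invertibleOfNonzero hc
    have h := Representation.char_orthonormal ρ ρ
    rw [if_pos ⟨Representation.Equiv.refl ρ⟩, inv_mul_eq_iff_eq_mul₀ hc, mul_one] at h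
    exact h
  · by_contra h'
    exact h ((sum_mul_inv χ ψ).1 h')

/-- A central element of the group algebra acts as zero on an irreducible representation if its
trace is zero. -/
theorem sum_smul_eq_zero [Fintype G] {V : Type*} [AddCommGroup V] [Module ℂ V]
    [FiniteDimensional ℂ V] (ρ : Representation ℂ G V) [hρ : ρ.IsIrreducible] {f : G → ℂ}
    (hf : ∀ g x, f (x * g * x⁻¹) = f g) (h0 : ∑ g, f g * ρ.character g = 0) :
    ∑ g, f g • ρ g = 0 := by
  have hcomm (x : G) : (∑ g, f g • ρ g) * ρ x = ρ x * ∑ g, f g • ρ g := by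
    simp only [Finset.sum_mul, Finset.mul_sum, smul_mul_assoc, mul_smul_comm, ← map_mul]
    refine Fintype.sum_equiv (MulAut.conj x⁻¹).toEquiv _ _ fun g => ?_
    have := hf g x⁻¹
    simp only [inv_inv] at this
    simp [mul_assoc, ← this]
  let t : Representation.IntertwiningMap ρ ρ :=
    ⟨∑ g, f g • ρ g, hcomm⟩
  -- Schur's lemma: the central element acts as a scalar c, with trace c · dim V.
  obtain ⟨c, hc⟩ :=
    (Representation.IsIrreducible.algebraMap_intertwiningMap_bijective_of_isAlgClosed
      (ρ := ρ)).2 t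
  have hc' : ∑ g, f g • ρ g = c • LinearMap.id := by
    change t.toLinearMap = _
    rw [← hc]
    rfl
  have htr : LinearMap.trace ℂ V (∑ g, f g • ρ g) = 0 := by
    simpa [Representation.character] using h0
  rw [hc', map_smul, LinearMap.trace_id, smul_eq_mul, mul_eq_zero] at htr
  rcases htr with h | h
  · rw [hc', h, zero_smul]
  · have : Subsingleton V := Module.finrank_zero_iff.1 (by exact_mod_cast h)
    exact Subsingleton.elim _ _

open scoped MonoidAlgebra in
/-- The irreducible characters separate the class functions. -/
theorem eq_zero_of_sum_mul_eq_zero [Fintype G] {f : G → ℂ} (hf : ∀ g x, f (x * g * x⁻¹) = f g)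
    (h0 : ∀ χ : Irr G, ∑ g, f g * χ g = 0) : f = 0 := by
  have : NeZero (Nat.card G : ℂ) := ⟨by exact_mod_cast Nat.card_pos.ne'⟩
  let z : ℂ[G] := ∑ g, MonoidAlgebra.single g (f g)
  -- For a maximal left ideal I, z acts as zero on the simple module ℂ[G]/I, so z · 1 = z lies in I.
  -- By Maschke's theorem the radical is zero.
  have hz : z ∈ Ring.jacobson ℂ[G] := by
    rw [Ring.jacobson, Module.jacobson, Submodule.mem_sInf]
    intro I hI
    have hs : IsSimpleModule ℂ[G] (ℂ[G] ⧸ I) := isSimpleModule_iff_isCoatom.2 hI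
    let ρ : Representation ℂ G (ℂ[G] ⧸ I) := Representation.ofModule' _
    have hact : ρ.asAlgebraHom = Algebra.lsmul ℂ ℂ (ℂ[G] ⧸ I) :=
      (MonoidAlgebra.lift ℂ _ G).apply_symm_apply _
    have hρ : ρ.IsIrreducible := by
      rw [Representation.irreducible_iff_isSimpleModule_asModule]
      refine IsSimpleModule.congr (N := ℂ[G] ⧸ I)
        { ρ.asModuleEquiv with map_smul' := fun r m => ?_ }
      exact LinearMap.congr_fun (DFunLike.congr_fun hact r) _
    have hfin : FiniteDimensional ℂ (ℂ[G] ⧸ I) := Module.Finite.trans ℂ[G] _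
    obtain ⟨χ, hχ⟩ := exists_eq_character ρ hρ
    have hzero := sum_smul_eq_zero ρ hf (by rw [← hχ]; exact h0 χ)
    have hz0 : ρ.asAlgebraHom z = 0 := by
      rw [← hzero]
      simp [z]
    rw [hact] at hz0
    have h1 := LinearMap.congr_fun hz0 (Submodule.Quotient.mk 1)
    change z • (Submodule.Quotient.mk 1 : ℂ[G] ⧸ I) = 0 at h1
    rw [← Submodule.Quotient.mk_smul, smul_eq_mul, mul_one] at h1
    exact (Submodule.Quotient.mk_eq_zero I).1 h1
  rw [IsSemisimpleRing.jacobson_eq_bot, Submodule.mem_bot] at hz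
  funext g
  have := congrArg (fun w : ℂ[G] => w.coeff g) hz
  classical
  simpa [z, MonoidAlgebra.coeff_single, Finsupp.single_apply] using this

variable (G) in
theorem exists_trivial : ∃ χ : Irr G, χ.1 = 1 := by
  have h : (Representation.trivial ℂ G ℂ).IsIrreducible := by
    have hs : Function.Injective (Subrepresentation.toSubmodule :
        Subrepresentation (Representation.trivial ℂ G ℂ) → _) :=
      Subrepresentation.toSubmodule_injective
    exact
      { exists_pair_ne := ⟨⊥, ⊤, fun h => bot_ne_top (congrArg Subrepresentation.toSubmodule h)⟩
        eq_bot_or_eq_top := fun U =>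
          (eq_bot_or_eq_top U.toSubmodule).imp (fun h => hs h) (fun h => hs h) }
  obtain ⟨χ, hχ⟩ := exists_eq_character _ h
  refine ⟨χ, hχ.trans ?_⟩
  ext g
  simp [Representation.character]

end Irr

/-! ### Partitions as spaces of block functions -/

namespace SCT

section Blocks

variable {α β : Type*}

/-- The functions that are constant on the blocks of a partition. -/
def blockFun (r : Setoid α) : Submodule ℂ (α → ℂ) where
  carrier := {f | ∀ x y, r x y → f x = f y}
  add_mem' hf hg x y h := congrArg₂ (· + ·) (hf x y h) (hg x y h)
  zero_mem' _ _ _ := rfl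
  smul_mem' c _ hf x y h := congrArg (c * ·) (hf x y h)

theorem star_mem_blockFun {r : Setoid α} {f : α → ℂ} (hf : f ∈ blockFun r) :
    star f ∈ blockFun r :=
  fun x y h => congrArg star (hf x y h)

theorem smul_mem_blockFun_iff {r : Setoid α} {f : α → ℂ} {c : ℂ} (hc : c ≠ 0) :
    c • f ∈ blockFun r ↔ f ∈ blockFun r :=
  (blockFun r).smul_mem_iff hc

theorem indicator_mem_blockFun {r : Setoid α} {S : Set α} :
    S.indicator (1 : α → ℂ) ∈ blockFun r ↔ ∀ x y, r x y → (x ∈ S ↔ y ∈ S) := by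
  classical
  refine forall₃_congr fun x y _ => ?_
  by_cases hx : x ∈ S <;> by_cases hy : y ∈ S <;> simp [hx, hy]

theorem indicator_class_mem_blockFun {r : Setoid α} {S : Set α} (hS : S ∈ r.classes) :
    S.indicator (1 : α → ℂ) ∈ blockFun r := by
  obtain ⟨z, rfl⟩ := hS
  exact indicator_mem_blockFun.2 fun x y h =>
    ⟨fun hx => r.trans' (r.symm' h) hx, fun hy => r.trans' h hy⟩

/-- The indicator functions of the blocks of s detect refinement. -/
theorem le_iff_blockFun_le {r s : Setoid α} : r ≤ s ↔ blockFun s ≤ blockFun r := by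
  refine ⟨fun h f hf x y hxy => hf x y (h hxy), fun h x y hxy => ?_⟩
  have h1 := h (indicator_class_mem_blockFun (s.mem_classes y))
  exact (indicator_mem_blockFun.1 h1 x y hxy).2 (s.refl' y)

/-- The functions constant on the blocks are spanned by the indicator functions of the blocks. -/
theorem blockFun_eq_span [Finite α] (r : Setoid α) :
    blockFun r = Submodule.span ℂ ((fun S : Set α => S.indicator (1 : α → ℂ)) '' r.classes) := by
  classical
  have := Fintype.ofFinite (Quotient r)
  apply le_antisymm
  · intro f hf
    have h : f = ∑ q : Quotient r, f q.out • {x | r x q.out}.indicator (1 : α → ℂ) := by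
      funext x
      rw [Finset.sum_apply, Finset.sum_eq_single (Quotient.mk r x)]
      · have hx : r x (Quotient.mk r x).out := r.symm' (Quotient.mk_out x)
        simp [hx, hf _ _ hx]
      · intro q _ hq
        have hx : ¬ r x q.out := fun hx => hq (by
          rw [← q.out_eq]
          exact Quotient.sound (r.symm' hx))
        simp [hx]
      · simp
    rw [h]
    exact Submodule.sum_mem _ fun q _ => Submodule.smul_mem _ _
      (Submodule.subset_span ⟨_, r.mem_classes _, rfl⟩)
  · rw [Submodule.span_le]
    rintro _ ⟨S, hS, rfl⟩
    exact indicator_class_mem_blockFun hS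

/-- Serves M(G), whose partitions have this form: compatibility need only be tested on one indicator
and the constant 1. -/
theorem exists_eq_of_mem_blockFun_ker {p : α → Prop} {f : α → ℂ}
    (hf : f ∈ blockFun (Setoid.ker p)) :
    ∃ c d : ℂ, f = c • {x | p x}.indicator (1 : α → ℂ) + d • 1 := by
  classical
  obtain ⟨d, hd⟩ : ∃ d, ∀ x, ¬ p x → f x = d := by
    by_cases h : ∃ y, ¬ p y
    · obtain ⟨y, hy⟩ := h
      exact ⟨f y, fun x hx => hf x y (Setoid.ker_def.2 (by simp [hx, hy]))⟩
    · exact ⟨0, fun x hx => absurd ⟨x, hx⟩ h⟩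
  obtain ⟨c, hc⟩ : ∃ c, ∀ x, p x → f x = c := by
    by_cases h : ∃ y, p y
    · obtain ⟨y, hy⟩ := h
      exact ⟨f y, fun x hx => hf x y (Setoid.ker_def.2 (by simp [hx, hy]))⟩
    · exact ⟨0, fun x hx => absurd ⟨x, hx⟩ h⟩
  refine ⟨c - d, d, funext fun x => ?_⟩
  by_cases hx : p x
  · simp [hx, hc x hx]
  · simp [hx, hd x hx]

/-- Functions constant on the blocks are functions on the set of blocks. -/
def blockFunEquiv (r : Setoid α) : (Quotient r → ℂ) ≃ₗ[ℂ] blockFun r where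
  toFun f := ⟨fun x => f (Quotient.mk r x), fun _ _ h => congrArg f (Quotient.sound h)⟩
  invFun f := Quotient.lift f.1 f.2
  map_add' _ _ := rfl
  map_smul' _ _ := rfl
  left_inv _ := funext fun q => q.inductionOn fun _ => rfl
  right_inv _ := rfl

theorem finrank_blockFun [Finite α] (r : Setoid α) :
    Module.finrank ℂ (blockFun r) = numBlocks r := by
  have := Fintype.ofFinite (Quotient r)
  rw [← (blockFunEquiv r).finrank_eq, Module.finrank_fintype_fun_eq_card, numBlocks,
    ← Nat.card_coe_set_eq, ← Nat.card_congr r.quotientEquivClasses, Nat.card_eq_fintype_card]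

theorem numBlocks_le_of_le [Finite α] {r s : Setoid α} (h : r ≤ s) :
    numBlocks s ≤ numBlocks r := by
  rw [← finrank_blockFun, ← finrank_blockFun]
  exact Submodule.finrank_mono (le_iff_blockFun_le.1 h)

theorem eq_of_le_of_numBlocks_le [Finite α] {r s : Setoid α} (h : r ≤ s)
    (hn : numBlocks r ≤ numBlocks s) : r = s := by
  refine le_antisymm h (le_iff_blockFun_le.2 ?_)
  rw [← finrank_blockFun, ← finrank_blockFun] at hn
  exact (Submodule.eq_of_le_of_finrank_le (le_iff_blockFun_le.1 h) hn).ge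

theorem numBlocks_le_card [Finite α] (r : Setoid α) : numBlocks r ≤ Nat.card α := by
  rw [numBlocks, ← Nat.card_coe_set_eq, ← Nat.card_congr r.quotientEquivClasses]
  exact Nat.card_le_card_of_surjective _ Quotient.mk_surjective

/-- A linear map that is injective on block functions and maps them to block functions. -/
theorem numBlocks_le_of_map_le [Finite α] [Finite β] {r : Setoid α} {s : Setoid β}
    {L : (α → ℂ) →ₗ[ℂ] (β → ℂ)} (hL : ∀ f ∈ blockFun r, L f ∈ blockFun s)
    (h0 : ∀ f ∈ blockFun r, L f = 0 → f = 0) : numBlocks r ≤ numBlocks s := by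
  rw [← finrank_blockFun, ← finrank_blockFun]
  refine LinearMap.finrank_le_finrank_of_injective (f := L.restrict hL) ?_
  rw [← LinearMap.ker_eq_bot, LinearMap.ker_eq_bot']
  exact fun f hf => Subtype.ext (h0 f f.2 (congrArg Subtype.val hf))

/-- An injective linear map between spaces of equal finite dimension is onto. This is how equality
of block counts enters. -/
theorem exists_of_numBlocks_eq [Finite α] [Finite β] {r : Setoid α} {s : Setoid β}
    {L : (α → ℂ) →ₗ[ℂ] (β → ℂ)} (hL : ∀ f ∈ blockFun r, L f ∈ blockFun s)
    (h0 : ∀ f ∈ blockFun r, L f = 0 → f = 0) (hn : numBlocks r = numBlocks s)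
    {g : β → ℂ} (hg : g ∈ blockFun s) : ∃ f ∈ blockFun r, L f = g := by
  rw [← finrank_blockFun, ← finrank_blockFun] at hn
  have hi : Function.Injective (L.restrict hL) := by
    rw [← LinearMap.ker_eq_bot, LinearMap.ker_eq_bot']
    exact fun f hf => Subtype.ext (h0 f f.2 (congrArg Subtype.val hf))
  obtain ⟨f, hf⟩ := (LinearMap.injective_iff_surjective_of_finrank_eq_finrank hn).1 hi ⟨g, hg⟩
  exact ⟨f, f.2, congrArg Subtype.val hf⟩

end Blocks

/-! ### The two transforms and their inversion -/

section Transforms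

variable {G : Type*} [Group G]

/-- The linear map sending `a` to `∑_χ a(χ) χ(1) χ`. -/
noncomputable def irrTransform [Fintype (Irr G)] : (Irr G → ℂ) →ₗ[ℂ] (G → ℂ) :=
  Fintype.linearCombination ℂ fun χ : Irr G => χ 1 • χ.1

/-- The linear map sending `f` to `χ ↦ (∑_g f(g) χ(g)) / χ(1)`. -/
noncomputable def classTransform [Fintype G] : (G → ℂ) →ₗ[ℂ] (Irr G → ℂ) :=
  Fintype.linearCombination ℂ fun (g : G) (χ : Irr G) => χ g / χ 1

theorem irrTransform_apply [Fintype (Irr G)] (a : Irr G → ℂ) (g : G) :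
    irrTransform a g = ∑ χ : Irr G, a χ * (χ 1 * χ g) := by
  simp [irrTransform, Fintype.linearCombination_apply]

theorem classTransform_apply [Fintype G] (f : G → ℂ) (χ : Irr G) :
    classTransform f χ = (∑ g, f g * χ g) / χ 1 := by
  simp [classTransform, Fintype.linearCombination_apply, Finset.sum_div, mul_div_assoc]

theorem sigma_eq [Fintype (Irr G)] (X : Set (Irr G)) :
    sigma X = irrTransform (X.indicator 1) := by
  funext g
  rw [irrTransform_apply, sigma, finsum_mem_def, finsum_eq_sum_of_fintype]
  refine Finset.sum_congr rfl fun χ _ => ?_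
  by_cases h : χ ∈ X <;> simp [h]

theorem omega_eq [Fintype G] (χ : Irr G) (K : Set G) :
    omega χ K = classTransform (K.indicator 1) χ := by
  rw [classTransform_apply, omega, finsum_mem_def, finsum_eq_sum_of_fintype]
  congr 1
  refine Finset.sum_congr rfl fun g _ => ?_
  by_cases h : g ∈ K <;> simp [h]

/-- A partition of `G` into normal subsets. -/
def IsNormalPartition (r : Setoid G) : Prop := ∀ g x, r (x * g * x⁻¹) g

variable [Fintype G] [Fintype (Irr G)]

omit [Fintype G] in
theorem irrTransform_conj (a : Irr G → ℂ) (g x : G) :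
    irrTransform a (x * g * x⁻¹) = irrTransform a g := by
  simp only [irrTransform_apply, Irr.map_conj]

/-- First orthogonality; the conjugation is there because `classTransform` pairs with χ, not with
its conjugate. -/
theorem classTransform_star_irrTransform (a : Irr G → ℂ) :
    classTransform (star (irrTransform a)) = (Nat.card G : ℂ) • star a := by
  classical
  funext ψ
  rw [classTransform_apply, div_eq_iff ψ.one_ne_zero]
  simp only [Pi.star_apply, irrTransform_apply, star_sum, star_mul', Irr.star_one, Finset.sum_mul]
  rw [Finset.sum_comm]
  have h (χ : Irr G) : ∑ g, star (a χ) * (χ 1 * star (χ g)) * ψ g =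
      star (a χ) * χ 1 * if ψ = χ then (Nat.card G : ℂ) else 0 := by
    rw [← Irr.sum_mul_star, Finset.mul_sum]
    exact Finset.sum_congr rfl fun g _ => by ring
  simp only [h, mul_ite, mul_zero, Finset.sum_ite_eq, Finset.mem_univ, if_true]
  simp only [Pi.smul_apply, Pi.star_apply, smul_eq_mul]
  ring

omit [Fintype (Irr G)] in
theorem card_ne_zero : (Nat.card G : ℂ) ≠ 0 := by
  exact_mod_cast Nat.card_pos.ne'

theorem eq_zero_of_irrTransform_eq_zero {a : Irr G → ℂ} (h : irrTransform a = 0) : a = 0 := by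
  have h1 := classTransform_star_irrTransform a
  rw [h, star_zero, map_zero] at h1
  exact star_eq_zero.1 ((smul_eq_zero.1 h1.symm).resolve_left card_ne_zero)

omit [Fintype (Irr G)] in
theorem eq_zero_of_classTransform_eq_zero {f : G → ℂ} (hf : ∀ g x, f (x * g * x⁻¹) = f g)
    (h : classTransform f = 0) : f = 0 := by
  refine Irr.eq_zero_of_sum_mul_eq_zero hf fun χ => ?_
  have h1 := congrFun h χ
  rw [classTransform_apply, Pi.zero_apply, div_eq_zero_iff] at h1
  exact h1.resolve_right χ.one_ne_zero

/-- The other inversion formula follows from the first, since `classTransform` is injective on class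
functions; no second orthogonality relation is needed. -/
theorem irrTransform_star_classTransform {f : G → ℂ} (hf : ∀ g x, f (x * g * x⁻¹) = f g) :
    irrTransform (star (classTransform f)) = (Nat.card G : ℂ) • star f := by
  have h : star (irrTransform (star (classTransform f))) - (Nat.card G : ℂ) • f = 0 := by
    refine eq_zero_of_classTransform_eq_zero (fun g x => ?_) ?_
    · simp only [Pi.sub_apply, Pi.star_apply, Pi.smul_apply, irrTransform_conj, hf]
    · rw [map_sub, classTransform_star_irrTransform, star_star, map_smul, sub_self]
  rw [← star_star (irrTransform _), sub_eq_zero.1 h, star_smul, star_natCast]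

/-- The σ_X are the transforms of block indicators, which span the block functions. -/
theorem classPartition_rel {𝒳 : Setoid (Irr G)} {g h : G} :
    classPartition 𝒳.classes g h ↔ ∀ a ∈ blockFun 𝒳, irrTransform a g = irrTransform a h := by
  constructor
  · intro hgh a ha
    let L : (Irr G → ℂ) →ₗ[ℂ] ℂ :=
      (LinearMap.proj (R := ℂ) (φ := fun _ => ℂ) g -
        LinearMap.proj (R := ℂ) (φ := fun _ => ℂ) h) ∘ₗ irrTransform
    have hle : blockFun 𝒳 ≤ LinearMap.ker L := by
      rw [blockFun_eq_span, Submodule.span_le]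
      rintro _ ⟨X, hX, rfl⟩
      have := hgh X hX
      rw [sigma_eq] at this
      exact sub_eq_zero.2 this
    exact sub_eq_zero.1 (hle ha)
  · intro hgh X hX
    rw [sigma_eq]
    exact hgh _ (indicator_class_mem_blockFun hX)

omit [Fintype (Irr G)] in
theorem irrPartition_rel {𝒦 : Setoid G} {χ ψ : Irr G} :
    irrPartition 𝒦.classes χ ψ ↔ ∀ f ∈ blockFun 𝒦, classTransform f χ = classTransform f ψ := by
  constructor
  · intro hgh a ha
    let L : (G → ℂ) →ₗ[ℂ] ℂ :=
      (LinearMap.proj (R := ℂ) (φ := fun _ => ℂ) χ -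
        LinearMap.proj (R := ℂ) (φ := fun _ => ℂ) ψ) ∘ₗ classTransform
    have hle : blockFun 𝒦 ≤ LinearMap.ker L := by
      rw [blockFun_eq_span, Submodule.span_le]
      rintro _ ⟨K, hK, rfl⟩
      have := hgh K hK
      rw [omega_eq, omega_eq] at this
      exact sub_eq_zero.2 this
    exact sub_eq_zero.1 (hle ha)
  · intro hgh K hK
    rw [omega_eq, omega_eq]
    exact hgh _ (indicator_class_mem_blockFun hK)

theorem le_classPartition_iff {𝒳 : Setoid (Irr G)} {𝒦 : Setoid G} :
    𝒦 ≤ classPartition 𝒳.classes ↔ ∀ a ∈ blockFun 𝒳, irrTransform a ∈ blockFun 𝒦 :=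
  ⟨fun h a ha _ _ hxy => classPartition_rel.1 (h hxy) a ha,
    fun h _ _ hxy => classPartition_rel.2 fun a ha => h a ha _ _ hxy⟩

omit [Fintype (Irr G)] in
theorem le_irrPartition_iff {𝒳 : Setoid (Irr G)} {𝒦 : Setoid G} :
    𝒳 ≤ irrPartition 𝒦.classes ↔ ∀ f ∈ blockFun 𝒦, classTransform f ∈ blockFun 𝒳 :=
  ⟨fun h a ha _ _ hxy => irrPartition_rel.1 (h hxy) a ha,
    fun h _ _ hxy => irrPartition_rel.2 fun a ha => h a ha _ _ hxy⟩

omit [Fintype G] [Fintype (Irr G)] in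
theorem IsNormalPartition.apply_conj {𝒦 : Setoid G} (h : IsNormalPartition 𝒦) {f : G → ℂ}
    (hf : f ∈ blockFun 𝒦) (g x : G) : f (x * g * x⁻¹) = f g :=
  hf _ _ (h g x)

end Transforms

/-! ### The operators C and I, and supercharacter theories as their fixed pairs -/

section Finite

variable {G : Type*} [Group G] [Finite G]

theorem isNormalPartition_classPartition (𝒳 : Set (Set (Irr G))) :
    IsNormalPartition (classPartition 𝒳) := by
  cases nonempty_fintype (Irr G)
  cases nonempty_fintype G
  intro g x X _
  rw [sigma_eq, irrTransform_conj]

theorem classPartition_mono {𝒳 𝒳' : Setoid (Irr G)} (h : 𝒳 ≤ 𝒳') :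
    classPartition 𝒳.classes ≤ classPartition 𝒳'.classes := by
  cases nonempty_fintype (Irr G)
  cases nonempty_fintype G
  exact le_classPartition_iff.2 fun a ha =>
    le_classPartition_iff.1 le_rfl a (le_iff_blockFun_le.1 h ha)

theorem irrPartition_mono {𝒦 𝒦' : Setoid G} (h : 𝒦 ≤ 𝒦') :
    irrPartition 𝒦.classes ≤ irrPartition 𝒦'.classes := by
  cases nonempty_fintype (Irr G)
  cases nonempty_fintype G
  exact le_irrPartition_iff.2 fun a ha =>
    le_irrPartition_iff.1 le_rfl a (le_iff_blockFun_le.1 h ha)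

/-- A normal set on which the values `ω_χ` are constant on the blocks of `𝒳` is a union of blocks
of `C(𝒳)`. -/
theorem mem_iff_of_classPartition {𝒳 : Setoid (Irr G)} {S : Set G}
    (hS : ∀ g ∈ S, ∀ x : G, x * g * x⁻¹ ∈ S) (h : 𝒳 ≤ irrPartition {S}) {g k : G}
    (hgk : classPartition 𝒳.classes g k) : g ∈ S ↔ k ∈ S := by
  cases nonempty_fintype (Irr G)
  cases nonempty_fintype G
  have hS' (g x : G) : x * g * x⁻¹ ∈ S ↔ g ∈ S :=
    ⟨fun hg => by simpa [mul_assoc] using hS _ hg x⁻¹, fun hg => hS g hg x⟩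
  have hf (g x : G) : S.indicator (1 : G → ℂ) (x * g * x⁻¹) = S.indicator 1 g := by
    classical
    simp [Set.indicator_apply, hS']
  -- Transforming this block function back gives |G| times the indicator of S, which is thus
  -- constant on the blocks of C(𝒳).
  have h1 : star (classTransform (S.indicator (1 : G → ℂ))) ∈ blockFun 𝒳 :=
    star_mem_blockFun fun χ ψ hχ => by
      rw [← omega_eq, ← omega_eq]
      exact h hχ S rfl
  have h2 := le_classPartition_iff.1 le_rfl _ h1
  rw [irrTransform_star_classTransform hf, smul_mem_blockFun_iff card_ne_zero] at h2
  have h3 := star_mem_blockFun h2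
  rw [star_star] at h3
  exact indicator_mem_blockFun.1 h3 g k hgk

theorem classPartition_irrPartition_le {𝒦 : Setoid G} (h𝒦 : IsNormalPartition 𝒦) :
    classPartition (irrPartition 𝒦.classes).classes ≤ 𝒦 := by
  intro g k hgk
  refine (mem_iff_of_classPartition (S := {x | 𝒦 x k}) ?_ ?_ hgk).2 (𝒦.refl' k)
  · exact fun g hg x => 𝒦.trans' (h𝒦 g x) hg
  · rintro χ ψ h _ rfl
    exact h _ (𝒦.mem_classes k)

theorem irrPartition_classPartition_le (𝒳 : Setoid (Irr G)) :
    irrPartition (classPartition 𝒳.classes).classes ≤ 𝒳 := by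
  cases nonempty_fintype (Irr G)
  cases nonempty_fintype G
  refine le_iff_blockFun_le.2 fun a ha => ?_
  have h1 := star_mem_blockFun (le_classPartition_iff.1 le_rfl a ha)
  have h2 := le_irrPartition_iff.1 le_rfl _ h1
  rw [classTransform_star_irrTransform, smul_mem_blockFun_iff card_ne_zero] at h2
  simpa using star_mem_blockFun h2

theorem numBlocks_le_classPartition (𝒳 : Setoid (Irr G)) :
    numBlocks 𝒳 ≤ numBlocks (classPartition 𝒳.classes) := by
  cases nonempty_fintype (Irr G)
  cases nonempty_fintype G
  exact numBlocks_le_of_map_le (le_classPartition_iff.1 le_rfl)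
    fun _ _ => eq_zero_of_irrTransform_eq_zero

theorem numBlocks_le_irrPartition {𝒦 : Setoid G} (h𝒦 : IsNormalPartition 𝒦) :
    numBlocks 𝒦 ≤ numBlocks (irrPartition 𝒦.classes) := by
  cases nonempty_fintype (Irr G)
  cases nonempty_fintype G
  exact numBlocks_le_of_map_le (le_irrPartition_iff.1 le_rfl)
    fun _ hf => eq_zero_of_classTransform_eq_zero (h𝒦.apply_conj hf)

omit [Finite G] in
theorem isTheory_iff {P : PartPair G} :
    IsTheory P ↔ numBlocks P.1 = numBlocks P.2 ∧ P.2 ≤ classPartition P.1.classes := by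
  refine and_congr_right fun _ => ⟨fun h g k hgk X hX => ?_, fun h X hX K hK g hg k hk => ?_⟩
  · exact h X hX _ (P.2.mem_classes k) g hgk k (P.2.refl' k)
  · exact h ((P.2.rel_iff_exists_classes).2 ⟨K, hK, hg, hk⟩) X hX

/-- If the numbers of blocks agree, the two compatibility conditions are equivalent. -/
theorem isTheory_of_le_irrPartition {P : PartPair G} (hn : numBlocks P.1 = numBlocks P.2)
    (hP : IsNormalPartition P.2) (h : P.1 ≤ irrPartition P.2.classes) : IsTheory P := by
  cases nonempty_fintype (Irr G)
  cases nonempty_fintype G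
  refine isTheory_iff.2 ⟨hn, le_classPartition_iff.2 fun a ha => ?_⟩
  obtain ⟨f, hf, hfa⟩ := exists_of_numBlocks_eq (le_irrPartition_iff.1 h)
    (fun _ hf => eq_zero_of_classTransform_eq_zero (hP.apply_conj hf)) hn.symm
    (star_mem_blockFun ha)
  rw [← star_star a, ← hfa, irrTransform_star_classTransform (hP.apply_conj hf)]
  exact Submodule.smul_mem _ _ (star_mem_blockFun hf)

/-- 𝒦 refines C(𝒳), which has at least |𝒳| = |𝒦| blocks, so the two coincide. -/
theorem IsTheory.classPartition_eq {P : PartPair G} (h : IsTheory P) :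
    classPartition P.1.classes = P.2 := by
  obtain ⟨hn, hle⟩ := isTheory_iff.1 h
  exact (eq_of_le_of_numBlocks_le hle (hn ▸ numBlocks_le_classPartition P.1)).symm

theorem IsTheory.isNormalPartition {P : PartPair G} (h : IsTheory P) : IsNormalPartition P.2 :=
  h.classPartition_eq ▸ isNormalPartition_classPartition _

theorem IsTheory.irrPartition_eq {P : PartPair G} (h : IsTheory P) :
    irrPartition P.2.classes = P.1 := by
  cases nonempty_fintype (Irr G)
  cases nonempty_fintype G
  obtain ⟨hn, hle⟩ := isTheory_iff.1 h
  apply le_antisymm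
  · have := irrPartition_classPartition_le P.1
    rwa [h.classPartition_eq] at this
  · refine le_irrPartition_iff.2 fun f hf => ?_
    obtain ⟨a, ha, haf⟩ := exists_of_numBlocks_eq (le_classPartition_iff.1 hle)
      (fun _ _ => eq_zero_of_irrTransform_eq_zero) hn (star_mem_blockFun hf)
    rw [← star_star f, ← haf, classTransform_star_irrTransform]
    exact Submodule.smul_mem _ _ (star_mem_blockFun ha)

theorem IsTheory.le_of_snd_le {P Q : PartPair G} (hP : IsTheory P) (hQ : IsTheory Q)
    (h : P.2 ≤ Q.2) : P ≤ Q := by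
  refine ⟨?_, h⟩
  rw [← hP.irrPartition_eq, ← hQ.irrPartition_eq]
  exact irrPartition_mono h

omit [Finite G] in
theorem classTransform_indicator_one [Fintype G] :
    classTransform (({1} : Set G).indicator (1 : G → ℂ)) = 1 := by
  funext χ
  rw [classTransform_apply, Finset.sum_eq_single 1 (by simp +contextual) (by simp)]
  simp [div_self χ.one_ne_zero]

omit [Finite G] in
/-- The regular character. -/
theorem irrTransform_one [Fintype G] [Fintype (Irr G)] :
    irrTransform (1 : Irr G → ℂ) = (Nat.card G : ℂ) • ({1} : Set G).indicator 1 := by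
  classical
  have hf (g x : G) : ({1} : Set G).indicator (1 : G → ℂ) (x * g * x⁻¹) =
      ({1} : Set G).indicator 1 g := by
    simp [Set.indicator_apply]
  have h := irrTransform_star_classTransform hf
  have h2 : star (({1} : Set G).indicator (1 : G → ℂ)) = ({1} : Set G).indicator 1 := by
    funext g
    by_cases hg : g = 1 <;> simp [hg]
  rwa [classTransform_indicator_one, h2, star_one] at h

/-- The regular character, the sum of all σ_X, is constant on superclasses and nonzero only at 1. -/
theorem IsTheory.eq_one_of_rel_one {P : PartPair G} (h : IsTheory P) {g : G} (hg : P.2 g 1) :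
    g = 1 := by
  cases nonempty_fintype (Irr G)
  cases nonempty_fintype G
  have h1 := le_classPartition_iff.1 (isTheory_iff.1 h).2 (1 : Irr G → ℂ) fun _ _ _ => rfl
  rw [irrTransform_one, smul_mem_blockFun_iff card_ne_zero] at h1
  exact (indicator_mem_blockFun.1 h1 g 1 hg).2 rfl

theorem IsTheory.snd_le_coarseTheory {P : PartPair G} (h : IsTheory P) :
    P.2 ≤ (coarseTheory G).2 := by
  intro g k hgk
  refine Setoid.ker_def.2 (propext ⟨?_, ?_⟩)
  · rintro rfl
    exact h.eq_one_of_rel_one (P.2.symm' hgk)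
  · rintro rfl
    exact h.eq_one_of_rel_one hgk

variable (G) in
-- Both transforms preserve the block functions, as seen on the generators. Compatibility in both
-- directions then forces equal block counts, without counting and without excluding the trivial
-- group.
theorem isTheory_coarseTheory : IsTheory (coarseTheory G) := by
  classical
  cases nonempty_fintype (Irr G)
  cases nonempty_fintype G
  obtain ⟨τ, hτ⟩ := Irr.exists_trivial G
  have hτ' (χ : Irr G) : χ.1 = 1 ↔ χ = τ := by rw [← hτ]; exact Subtype.coe_inj
  have hS : irrTransform (({τ} : Set (Irr G)).indicator 1) = 1 := by
    rw [← sigma_eq]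
    funext g
    simp [sigma, hτ]
  have hT := classTransform_star_irrTransform (({τ} : Set (Irr G)).indicator (1 : Irr G → ℂ))
  rw [hS, star_one] at hT
  have hnormal : IsNormalPartition (coarseTheory G).2 := fun g x =>
    Setoid.ker_def.2 (propext (by simp))
  have hδ : ({1} : Set G).indicator 1 ∈ blockFun (coarseTheory G).2 :=
    indicator_mem_blockFun.2 fun g k h => (Setoid.ker_def.1 h).to_iff
  have hε : ({τ} : Set (Irr G)).indicator 1 ∈ blockFun (coarseTheory G).1 :=
    indicator_mem_blockFun.2 fun χ ψ h => by
      rw [Set.mem_singleton_iff, Set.mem_singleton_iff, ← hτ', ← hτ']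
      exact (Setoid.ker_def.1 h).to_iff
  have hX : (coarseTheory G).1 ≤ irrPartition (coarseTheory G).2.classes := by
    refine le_irrPartition_iff.2 fun f hf => ?_
    obtain ⟨c, d, rfl⟩ := exists_eq_of_mem_blockFun_ker hf
    rw [map_add, map_smul, map_smul, hT]
    refine add_mem (Submodule.smul_mem _ _ ?_)
      (Submodule.smul_mem _ _ (Submodule.smul_mem _ _ (star_mem_blockFun hε)))
    exact (classTransform_indicator_one (G := G)).symm ▸ fun _ _ _ => rfl
  have hK : (coarseTheory G).2 ≤ classPartition (coarseTheory G).1.classes := by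
    refine le_classPartition_iff.2 fun a ha => ?_
    obtain ⟨c, d, rfl⟩ := exists_eq_of_mem_blockFun_ker ha
    simp only [hτ', Set.ofPred_eq_eq_singleton]
    rw [map_add, map_smul, map_smul, hS, irrTransform_one]
    exact add_mem (Submodule.smul_mem _ _ fun _ _ _ => rfl)
      (Submodule.smul_mem _ _ (Submodule.smul_mem _ _ hδ))
  refine isTheory_iff.2 ⟨le_antisymm ?_ ?_, hK⟩
  · exact (numBlocks_le_classPartition _).trans (numBlocks_le_of_le hK)
  · exact (numBlocks_le_irrPartition hnormal).trans (numBlocks_le_of_le hX)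

theorem IsTheory.le_coarseTheory {P : PartPair G} (h : IsTheory P) : P ≤ coarseTheory G :=
  h.le_of_snd_le (isTheory_coarseTheory G) h.snd_le_coarseTheory

end Finite

end SCT

/-! ### The iteration and the algorithm -/

namespace SCT

variable {G : Type*} [Group G] [Finite G]

theorem isNormalPartition_classSeq (𝒦 : Set (Set G)) (n : ℕ) :
    IsNormalPartition (classSeq 𝒦 n) :=
  isNormalPartition_classPartition _

theorem numBlocks_irrSeq_le (𝒦 : Set (Set G)) (n : ℕ) :
    numBlocks (irrSeq 𝒦 n) ≤ numBlocks (classSeq 𝒦 n) :=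
  numBlocks_le_classPartition _

theorem numBlocks_classSeq_le (𝒦 : Set (Set G)) (n : ℕ) :
    numBlocks (classSeq 𝒦 n) ≤ numBlocks (irrSeq 𝒦 (n + 1)) :=
  numBlocks_le_irrPartition (isNormalPartition_classSeq 𝒦 n)

/-- Otherwise the block count grows in every round, beyond |G|. -/
theorem exists_stabilizes (𝒦 : Set (Set G)) : ∃ n, Stabilizes 𝒦 n := by
  by_contra! h
  have hle (n : ℕ) : n ≤ numBlocks (classSeq 𝒦 n) := by
    induction n with
    | zero => exact Nat.zero_le _
    | succ n ih =>
      have h1 := (numBlocks_classSeq_le 𝒦 n).lt_of_ne fun he => h n (Or.inr he)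
      have h2 := numBlocks_irrSeq_le 𝒦 (n + 1)
      omega
  have h1 := hle (Nat.card G + 1)
  have h2 := numBlocks_le_card (classSeq 𝒦 (Nat.card G + 1))
  omega

theorem Stabilizes.isTheory {𝒦 : Set (Set G)} {n : ℕ} (h : Stabilizes 𝒦 n) :
    IsTheory (seqPair 𝒦 n) := by
  rcases h with h | h
  · have ht : IsTheory (irrSeq 𝒦 n, classSeq 𝒦 n) := isTheory_iff.2 ⟨h, le_rfl⟩
    -- The pair with the preceding partition is already a theory, so applying I once more returns
    -- that partition.
    have he : seqPair 𝒦 n = (irrSeq 𝒦 n, classSeq 𝒦 n) :=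
      Prod.ext ht.irrPartition_eq rfl
    rwa [he]
  · exact isTheory_of_le_irrPartition h.symm (isNormalPartition_classSeq 𝒦 n) le_rfl

/-- A theory that is compatible with the initial collection stays below the whole sequence. -/
theorem IsTheory.le_seqPair {P : PartPair G} (hP : IsTheory P) {𝒦 : Set (Set G)}
    (h : P.1 ≤ irrPartition 𝒦) (n : ℕ) : P ≤ seqPair 𝒦 n := by
  have hc (n : ℕ) (hn : P.1 ≤ irrSeq 𝒦 n) : P.2 ≤ classSeq 𝒦 n :=
    hP.classPartition_eq.ge.trans (classPartition_mono hn)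
  have hi (n : ℕ) : P.1 ≤ irrSeq 𝒦 n := by
    induction n with
    | zero => exact h
    | succ n ih => exact hP.irrPartition_eq.ge.trans (irrPartition_mono (hc n ih))
  exact ⟨hi (n + 1), hc n (hi n)⟩

theorem irrSeq_le (𝒦 : Set (Set G)) (n : ℕ) : irrSeq 𝒦 n ≤ irrPartition 𝒦 := by
  induction n with
  | zero => exact le_rfl
  | succ n ih => exact (irrPartition_classPartition_le _).trans ih

theorem classSeq_le {𝒦 : Setoid G} (h𝒦 : IsNormalPartition 𝒦) (n : ℕ) :
    classSeq 𝒦.classes n ≤ 𝒦 :=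
  (classPartition_mono (irrSeq_le _ n)).trans (classPartition_irrPartition_le h𝒦)

/-- S always remains a union of blocks, so it can be lost as a block only by splitting. -/
theorem mem_iff_of_classSeq {S : Set G} (hS : IsCandidate S) {n : ℕ} {g k : G}
    (h : classSeq {S} n g k) : g ∈ S ↔ k ∈ S :=
  mem_iff_of_classPartition hS.2.2.1 (irrSeq_le _ n) h

theorem IsTheory.le_seqPair_of_mem {P : PartPair G} (hP : IsTheory P) {S : Set G}
    (h : S ∈ P.2.classes) (n : ℕ) : P ≤ seqPair {S} n := by
  refine hP.le_seqPair (hP.irrPartition_eq.ge.trans ?_) n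
  rintro χ ψ hχ _ rfl
  exact hχ _ h

/-- A superclass that is a candidate remains a block throughout the computation. -/
theorem IsTheory.mem_classSeq {P : PartPair G} (hP : IsTheory P) {S : Set G}
    (hS : IsCandidate S) (h : S ∈ P.2.classes) (n : ℕ) : S ∈ (classSeq {S} n).classes := by
  obtain ⟨y, hy⟩ := h
  refine ⟨y, Set.ext fun x => ⟨fun hx => ?_, fun hx => ?_⟩⟩
  · have hx' : P.2 x y := by rw [hy] at hx; exact hx
    exact (hP.le_seqPair_of_mem ⟨y, hy⟩ n).2 hx'
  · have hyS : y ∈ S := by rw [hy]; exact P.2.refl' y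
    exact (mem_iff_of_classSeq hS hx).2 hyS

theorem exists_stopsAt (S : Set G) : ∃ n, StopsAt S n := by
  obtain ⟨n, hn⟩ := exists_stabilizes {S}
  exact ⟨_, csInf_mem ⟨n, Or.inr hn⟩, fun _ h => csInf_le (OrderBot.bddBelow _) h⟩

theorem StopsAt.isCoarsestWith {S : Set G} {n : ℕ} (hn : StopsAt S n)
    (h : S ∈ (classSeq {S} n).classes) : IsCoarsestWith S (seqPair {S} n) :=
  -- As S is still a block, the stop was caused by stabilization.
  ⟨⟨(hn.1.resolve_left (not_not_intro h)).isTheory, h⟩,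
    fun _ hT => hT.1.le_seqPair_of_mem hT.2 n⟩

omit [Finite G] in
theorem sInf_snd_rel {F : Set (PartPair G)} {g k : G} :
    sInf (Prod.snd '' F) g k ↔ ∀ P ∈ F, P.2 g k :=
  Set.forall_mem_image (p := fun r : Setoid G => r g k)

theorem isMeet_seqPair {F : Set (PartPair G)} (hF : ∀ P ∈ F, IsTheory P) {n : ℕ}
    (hn : Stabilizes (sInf (Prod.snd '' F)).classes n) :
    IsMeet F (seqPair (sInf (Prod.snd '' F)).classes n) := by
  have hnormal : IsNormalPartition (sInf (Prod.snd '' F)) := fun g x =>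
    sInf_snd_rel.2 fun P hP => (hF P hP).isNormalPartition g x
  refine ⟨⟨hn.isTheory, fun P hP => ?_⟩, fun T hT => ?_⟩
  · exact hn.isTheory.le_of_snd_le (hF P hP)
      ((classSeq_le hnormal n).trans (sInf_le ⟨P, hP, rfl⟩))
  · refine hT.1.le_seqPair (hT.1.irrPartition_eq.ge.trans (irrPartition_mono ?_)) n
    refine le_sInf ?_
    rintro _ ⟨P, hP, rfl⟩
    exact (hT.2 hP).2

theorem exists_isLeast_stabilizes (𝒦 : Set (Set G)) : ∃ n, IsLeast {m | Stabilizes 𝒦 m} n := by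
  obtain ⟨n, hn⟩ := exists_stabilizes 𝒦
  exact ⟨_, csInf_mem ⟨n, hn⟩, fun _ h => csInf_le (OrderBot.bddBelow _) h⟩

theorem isTheory_of_mem_firstStep {P : PartPair G} (h : P ∈ firstStep G) : IsTheory P := by
  obtain ⟨S, -, n, hn, hS, rfl⟩ := h
  exact (hn.isCoarsestWith hS).1.1

theorem isTheory_of_mem_algorithmOutput {P : PartPair G} (h : P ∈ algorithmOutput G) :
    IsTheory P := by
  rcases h with rfl | h | ⟨F, -, -, hP⟩
  · exact isTheory_coarseTheory G
  · exact isTheory_of_mem_firstStep h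
  · exact hP.1.1

/-- Two nontrivial superclasses that both contain more than half of the nontrivial conjugacy
classes meet. -/
theorem not_disjoint_of_not_isCandidate {S S' : Set G} (hS : S.Nonempty) (hS' : S'.Nonempty)
    (h1 : (1 : G) ∉ S) (h1' : (1 : G) ∉ S') (hc : ∀ g ∈ S, ∀ x : G, x * g * x⁻¹ ∈ S)
    (hc' : ∀ g ∈ S', ∀ x : G, x * g * x⁻¹ ∈ S') (h : ¬ IsCandidate S) (h' : ¬ IsCandidate S') :
    ¬ Disjoint S S' := by
  intro hd
  have hn := not_le.1 fun hle => h ⟨hS, h1, hc, hle⟩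
  have hn' := not_le.1 fun hle => h' ⟨hS', h1', hc', hle⟩
  have hfin : Finite (ConjClasses G) := Quotient.finite _
  have hdc : Disjoint {c : ConjClasses G | c.carrier ⊆ S} {c : ConjClasses G | c.carrier ⊆ S'} := by
    refine Set.disjoint_left.2 fun c hcS hcS' => ?_
    obtain ⟨a, rfl⟩ := c.exists_rep
    exact Set.disjoint_left.1 hd (hcS ConjClasses.mem_carrier_mk)
        (hcS' ConjClasses.mem_carrier_mk)
  have hsub : {c : ConjClasses G | c.carrier ⊆ S} ∪ {c : ConjClasses G | c.carrier ⊆ S'} ⊆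
      {c : ConjClasses G | c ≠ 1} := by
    rintro c (hcS | hcS) rfl
    · exact h1 (hcS ConjClasses.mem_carrier_mk)
    · exact h1' (hcS ConjClasses.mem_carrier_mk)
  have hle := Set.ncard_le_ncard hsub (Set.toFinite _)
  rw [Set.ncard_union_eq hdc (Set.toFinite _) (Set.toFinite _)] at hle
  omega

/-- A theory is determined by its superclasses that are candidates. -/
theorem IsTheory.le_of_candidates {T T' : PartPair G} (hT : IsTheory T) (hT' : IsTheory T')
    (h : ∀ S ∈ T.2.classes, IsCandidate S → ∀ g k, T'.2 g k → (g ∈ S ↔ k ∈ S)) : T' ≤ T := by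
  refine hT'.le_of_snd_le hT fun g k hgk => ?_
  by_cases hg1 : g = 1
  · subst hg1
    rw [hT'.eq_one_of_rel_one (T'.2.symm' hgk)]
  by_cases hk1 : k = 1
  · subst hk1
    exact absurd (hT'.eq_one_of_rel_one hgk) hg1
  by_cases hg : IsCandidate {x | T.2 x g}
  · exact T.2.symm' ((h _ (T.2.mem_classes g) hg g k hgk).1 (T.2.refl' g))
  by_cases hk : IsCandidate {x | T.2 x k}
  · exact (h _ (T.2.mem_classes k) hk g k hgk).2 (T.2.refl' k)
  have hone {y : G} (hy : y ≠ 1) : (1 : G) ∉ {x | T.2 x y} := fun h1 =>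
    hy (hT.eq_one_of_rel_one (T.2.symm' h1))
  have hconj (y : G) : ∀ g ∈ {x | T.2 x y}, ∀ x : G, x * g * x⁻¹ ∈ {x | T.2 x y} :=
    fun g hg x => T.2.trans' (hT.isNormalPartition g x) hg
  -- Neither superclass is a candidate, so they intersect and are therefore equal.
  obtain ⟨x, hxg, hxk⟩ := Set.not_disjoint_iff.1 (not_disjoint_of_not_isCandidate
    (S := {x | T.2 x g}) (S' := {x | T.2 x k})
    ⟨g, T.2.refl' g⟩ ⟨k, T.2.refl' k⟩ (hone hg1) (hone hk1) (hconj g) (hconj k) hg hk)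
  exact T.2.trans' (T.2.symm' hxg) hxk

theorem mem_algorithmOutput {T : PartPair G} (hT : IsTheory T) : T ∈ algorithmOutput G := by
  -- The pairs L(S) for the candidate superclasses S of T. T is their greatest lower bound among
  -- theories; if F has fewer than two members, T is M(G) or the one L(S).
  let F : Set (PartPair G) := {P | ∃ S ∈ T.2.classes, IsCandidate S ∧ ∃ n, StopsAt S n ∧
    P = seqPair {S} n}
  have hF : F ⊆ firstStep G := by
    rintro _ ⟨S, hST, hS, n, hn, rfl⟩
    exact ⟨S, hS, n, hn, hT.mem_classSeq hS hST n, rfl⟩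
  have hTF : T ∈ lowerBounds F := by
    rintro _ ⟨S, hST, hS, n, hn, rfl⟩
    exact hT.le_seqPair_of_mem hST n
  have hmax (T' : PartPair G) (hT' : IsTheory T') (h : T' ∈ lowerBounds F) : T' ≤ T := by
    refine hT.le_of_candidates hT' fun S hST hS g k hgk => ?_
    obtain ⟨n, hn⟩ := exists_stopsAt S
    exact mem_iff_of_classSeq hS ((h ⟨S, hST, hS, n, hn, rfl⟩).2 hgk)
  by_cases hnt : F.Nontrivial
  · exact Or.inr (Or.inr ⟨F, hF, hnt, ⟨hT, hTF⟩, fun T' hT' => hmax T' hT'.1 hT'.2⟩)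
  rcases (Set.not_nontrivial_iff.1 hnt).eq_empty_or_singleton with he | ⟨P, hP⟩
  · refine Or.inl (le_antisymm hT.le_coarseTheory (hmax _ (isTheory_coarseTheory G) ?_))
    simp [he]
  · have hPF : P ∈ firstStep G := hF (hP ▸ rfl)
    have : T = P := le_antisymm (hTF (hP ▸ rfl))
      (hmax P (isTheory_of_mem_firstStep hPF) (by simp [hP]))
    exact Or.inr (Or.inl (this ▸ hPF))

end SCT

theorem mainTheorem8 (G : Type*) [Group G] [Finite G] :
    (∀ S : Set G, SCT.IsCandidate S → ∃ n : ℕ, SCT.StopsAt S n ∧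
      (S ∈ (SCT.classSeq {S} n).classes → SCT.IsCoarsestWith S (SCT.seqPair {S} n)) ∧
      (S ∉ (SCT.classSeq {S} n).classes →
        ¬ ∃ P : SCT.PartPair G, SCT.IsTheory P ∧ S ∈ P.2.classes)) ∧
    (∀ F : Set (SCT.PartPair G), F.Nonempty → (∀ P ∈ F, SCT.IsTheory P) →
      ∃ n : ℕ, IsLeast {m : ℕ | SCT.Stabilizes (sInf (Prod.snd '' F)).classes m} n ∧
        SCT.IsMeet F (SCT.seqPair (sInf (Prod.snd '' F)).classes n)) ∧
    SCT.algorithmOutput G = {P : SCT.PartPair G | SCT.IsTheory P} := by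
  refine ⟨fun S hS => ?_, fun F _ hF => ?_, ?_⟩
  · obtain ⟨n, hn⟩ := SCT.exists_stopsAt S
    exact ⟨n, hn, hn.isCoarsestWith, fun h ⟨P, hP, hSP⟩ => h (hP.mem_classSeq hS hSP n)⟩
  · obtain ⟨n, hn⟩ := SCT.exists_isLeast_stabilizes (sInf (Prod.snd '' F)).classes
    exact ⟨n, hn, SCT.isMeet_seqPair hF hn.1⟩
  · exact Set.ext fun P => ⟨SCT.isTheory_of_mem_algorithmOutput, SCT.mem_algorithmOutput⟩
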